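/- **Theorem.** Let $P$ be a finite dismantlable partially ordered set, and let $\Phi$ be a functor from $P$ (viewed as a category) to the category of $\langle\vee,0\rangle$-semilattices and $\langle\vee,0\rangle$-homomorphisms such that $\Phi(x)$ is a finite Boolean semilattice for every $x\in P$. Then there is a functor $\Psi$ from $P$ to the category of partially ordered $\mathbb{Q}$-vector spaces with order-unit and positive homomorphisms such that every $\Psi(x)$ is pseudo-simplicial and the functors $\Phi$ and $\mathrm{Id}_c\circ\Psi$ are naturally isomorphic; that is, there are isomorphisms $\iota_x\colon\Phi(x)\to\mathrm{Id}_c(\Psi(x))$ (for $x\in P$) with $\iota_y\circ\Phi(x\le y)=\mathrm{Id}_c(\Psi(x\le y))\circ\iota_x$ for all $x\le y$ in $P$. Here the following definitions are used. * An element of a finite poset is *doubly-irreducible* if it has at most one upper cover and at most one lower cover. A finite poset $P$ with $n$ elements is *dismantlable* if there is a chain $\varnothing=P_0\subset P_1\subset\dots\subset P_n=P$ of subsets such that, for each $i<n$, $P_i=P_{i+1}\setminus\{x_i\}$ for some doubly-irreducible element $x_i$ of $P_{i+1}$ (with the induced order). * A *finite Boolean semilattice* is a $\langle\vee,0\rangle$-semilattice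 that is finite and whose order is that of a Boolean lattice (equivalently, it is isomorphic to $\mathbf{2}^q$ for some $q\ge0$). * An *ideal* of a partially ordered abelian group $G$ is a subgroup $H$ that is directed (every element of $H$ is a difference of two elements of $H\cap G^+$) and convex ($0\le x\le a\in H$ implies $x\in H$). A *compact ideal* is an ideal generated by a finite set; $\mathrm{Id}_c\,G$ is the $\langle\vee,0\rangle$-semilattice of compact ideals of $G$ under inclusion. A *positive homomorphism* is an order-preserving group homomorphism; for such $f\colon G\to H$, $(\mathrm{Id}_c f)(I)$ is the compact ideal of $H$ generated by $f[I]$. * An *order-unit* of $G$ is an $a\in G^+$ such that every $x\in G$ satisfies $-na\le x\le na$ for some $n\in\mathbb{Z}^+$. In a partially ordered vector space with order-unit, the order-unit is part of the structure, but positive homomorphisms need not preserve it. * For a nonempty finite set $X$, $\mathbb{Q}_X$ is the vector space $\mathbb{Q}^X$ with the order $f\le g$ iff $f=g$ or $f(x)<g(x)$ for all $x\in X$, and with the constant function $1$ as order-unit. A partially ordered vector space with order-unit is *pseudo-simplicial* if it is isomorphic, as a partially ordered vector space with order-unit, to a finite (possibly empty) direct sum, with componentwise order and order-unit, of spaces $\mathbb{Q}_X$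 with $X$ nonempty and finite. -/

import Mathlib

open CategoryTheory

universe u w

/-! ### Dismantlable finite posets -/

/-- `x` has at most one upper cover and at most one lower cover. -/
def IsDoublyIrreducible {P : Type w} [PartialOrder P] (x : P) : Prop :=
  {y : P | x ⋖ y}.Subsingleton ∧ {y : P | y ⋖ x}.Subsingleton

/-- `Q = R \ {x}` for some doubly-irreducible element `x` of the poset `R` (with the order induced
from `P`). -/
def RemovesIrreducible {P : Type w} [PartialOrder P] (Q R : Set P) : Prop :=
  ∃ x : R, IsDoublyIrreducible x ∧ Q = R \ {(x : P)}

/-- A finite poset of cardinality `n` is dismantlable if there is a chain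
`∅ = P₀, P₁, …, Pₙ = P` of subsets in which each `Pᵢ` is obtained from `Pᵢ₊₁` by removing one
doubly-irreducible element of `Pᵢ₊₁`. -/
def IsDismantlable (P : Type w) [PartialOrder P] : Prop :=
  ∃ c : ℕ → Set P, c 0 = ∅ ∧ c (Nat.card P) = Set.univ ∧
    ∀ i < Nat.card P, RemovesIrreducible (c i) (c (i + 1))

/-! ### Finite Boolean semilattices -/

/-- A `⟨∨, 0⟩`-semilattice that is finite and is, as an ordered set, a Boolean lattice. -/
def IsFiniteBoolean (S : SemilatSupCat.{u}) : Prop :=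
  Finite S ∧ ∃ (B : Type u) (_ : BooleanAlgebra B), Nonempty (S ≃o B)

/-! ### Ideals of partially ordered abelian groups -/

section Ideals

variable {G : Type*} [AddCommGroup G] [PartialOrder G]

/-- An ideal: a directed, convex subgroup. -/
structure IsOrderIdeal (H : AddSubgroup G) : Prop where
  directed : ∀ x ∈ H, ∃ y ∈ H, ∃ z ∈ H, 0 ≤ y ∧ 0 ≤ z ∧ x = y - z
  convex : ∀ a ∈ H, ∀ x : G, 0 ≤ x → x ≤ a → x ∈ H

/-- The intersection of all ideals that contain `S`. -/
def idealSpan (S : Set G) : AddSubgroup G :=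
  sInf {J : AddSubgroup G | IsOrderIdeal J ∧ S ⊆ J}

/-- A compact ideal: an ideal that is generated, as an ideal, by a finite set. -/
def IsCompactIdeal (H : AddSubgroup G) : Prop :=
  IsOrderIdeal H ∧ ∃ F : Set G, F.Finite ∧ H = idealSpan F

theorem subset_idealSpan (S : Set G) : S ⊆ idealSpan S := by
  intro x hx
  simp only [idealSpan, SetLike.mem_coe, AddSubgroup.mem_sInf]
  exact fun J hJ => hJ.2 hx

theorem idealSpan_le {S : Set G} {J : AddSubgroup G} (hJ : IsOrderIdeal J) (h : S ⊆ J) :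
    idealSpan S ≤ J := sInf_le ⟨hJ, h⟩

theorem map_nonneg_of_nonneg {H : Type*} [AddCommGroup H] [PartialOrder H]
    (f : G →+o H) {a : G} (ha : 0 ≤ a) : 0 ≤ f a := by
  simpa using OrderHomClass.mono f ha

variable [IsOrderedAddMonoid G]

/-- `G(a) = {x | ∃ n, -n a ≤ x ≤ n a}`; only used for `a ≥ 0`. -/
def principalIdeal (a : G) : AddSubgroup G where
  carrier := {x | ∃ n : ℕ, -(n • a) ≤ x ∧ x ≤ n • a}
  zero_mem' := ⟨0, by simp⟩
  add_mem' := by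
    rintro x y ⟨m, h1, h2⟩ ⟨n, h3, h4⟩
    refine ⟨m + n, ?_, ?_⟩
    · rw [add_nsmul, neg_add]; exact add_le_add h1 h3
    · rw [add_nsmul]; exact add_le_add h2 h4
  neg_mem' := by
    rintro x ⟨n, h1, h2⟩
    exact ⟨n, neg_le_neg h2, by simpa using neg_le_neg h1⟩

theorem mem_principalIdeal {a : G} {x : G} :
    x ∈ principalIdeal a ↔ ∃ n : ℕ, -(n • a) ≤ x ∧ x ≤ n • a := Iff.rfl

theorem self_mem_principalIdeal (a : G) (ha : 0 ≤ a) : a ∈ principalIdeal a :=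
  ⟨1, by simpa using (neg_nonpos.2 ha).trans ha, by simp⟩

theorem IsOrderIdeal.mem_of_le {H : AddSubgroup G} (hH : IsOrderIdeal H) {a x : G} (ha : a ∈ H)
    (h1 : -a ≤ x) (h2 : x ≤ a) : x ∈ H := by
  have h : x + a ∈ H := hH.convex (a + a) (H.add_mem ha ha) _
    (by simpa using add_le_add_left h1 a) (by simpa using add_le_add_left h2 a)
  simpa using H.sub_mem h ha

theorem isOrderIdeal_principalIdeal (a : G) (ha : 0 ≤ a) : IsOrderIdeal (principalIdeal a) where
  directed := by
    rintro x ⟨n, h1, h2⟩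
    have hn : n • a ∈ principalIdeal a :=
      AddSubgroup.nsmul_mem _ (self_mem_principalIdeal a ha) n
    refine ⟨x + n • a, AddSubgroup.add_mem _ ⟨n, h1, h2⟩ hn, n • a, hn, ?_, nsmul_nonneg ha n, ?_⟩
    · simpa using add_le_add_left h1 (n • a)
    · simp
  convex := by
    rintro b ⟨n, _, h2⟩ x hx hxb
    exact ⟨n, (neg_nonpos.2 (nsmul_nonneg ha n)).trans hx, hxb.trans h2⟩

theorem principalIdeal_le {a : G} {J : AddSubgroup G} (hJ : IsOrderIdeal J)
    (h : a ∈ J) : principalIdeal a ≤ J := by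
  rintro x ⟨n, h1, h2⟩
  exact hJ.mem_of_le (J.nsmul_mem h n) h1 h2

/-- If every ideal containing `S` contains `a ≥ 0`, and `S ⊆ G(a)`, then `S` generates `G(a)`. -/
theorem idealSpan_eq_principalIdeal {S : Set G} {a : G} (ha : 0 ≤ a)
    (h1 : S ⊆ principalIdeal a)
    (h2 : ∀ J : AddSubgroup G, IsOrderIdeal J → S ⊆ J → a ∈ J) :
    idealSpan S = principalIdeal a :=
  le_antisymm (idealSpan_le (isOrderIdeal_principalIdeal a ha) h1)
    (le_sInf fun J hJ => principalIdeal_le hJ.1 (h2 J hJ.1 hJ.2))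

theorem isCompactIdeal_principalIdeal (a : G) (ha : 0 ≤ a) :
    IsCompactIdeal (principalIdeal a) :=
  ⟨isOrderIdeal_principalIdeal a ha, {a}, Set.finite_singleton a,
    (idealSpan_eq_principalIdeal ha (by simpa using self_mem_principalIdeal a ha)
      (by simp)).symm⟩

/-- The compact ideals are exactly the `G(a)`. -/
theorem isCompactIdeal_iff {H : AddSubgroup G} :
    IsCompactIdeal H ↔ ∃ a : G, 0 ≤ a ∧ H = principalIdeal a := by
  constructor
  · rintro ⟨hH, F, hF, rfl⟩
    have key : ∀ x ∈ F, ∃ b ∈ idealSpan F, 0 ≤ b ∧ -b ≤ x ∧ x ≤ b := by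
      intro x hx
      obtain ⟨y, hy, z, hz, hy0, hz0, rfl⟩ := hH.directed x (subset_idealSpan F hx)
      refine ⟨y + z, add_mem hy hz, add_nonneg hy0 hz0, ?_, ?_⟩
      · rw [neg_add, sub_eq_add_neg]
        exact add_le_add_left ((neg_nonpos.2 hy0).trans hy0) _
      · rw [sub_eq_add_neg]
        exact add_le_add_right ((neg_nonpos.2 hz0).trans hz0) _
    choose! b hb hb0 hb1 hb2 using key
    have hnn : ∀ x ∈ hF.toFinset, 0 ≤ b x := fun x hx => hb0 x (hF.mem_toFinset.1 hx)
    have ha : 0 ≤ ∑ x ∈ hF.toFinset, b x := Finset.sum_nonneg hnn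
    refine ⟨_, ha, le_antisymm
      (idealSpan_le (isOrderIdeal_principalIdeal _ ha) fun x hx => ?_)
      (principalIdeal_le hH (sum_mem fun x hx => hb x (hF.mem_toFinset.1 hx)))⟩
    have hle := Finset.single_le_sum hnn (hF.mem_toFinset.2 hx)
    exact ⟨1, by simpa using (neg_le_neg hle).trans (hb1 x hx),
      by simpa using (hb2 x hx).trans hle⟩
  · rintro ⟨a, ha, rfl⟩
    exact isCompactIdeal_principalIdeal a ha

theorem idealSpan_union (a b : G) (ha : 0 ≤ a) (hb : 0 ≤ b) :
    idealSpan ((principalIdeal a : Set G) ∪ (principalIdeal b : Set G)) =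
      principalIdeal (a + b) := by
  have hI := isOrderIdeal_principalIdeal (a + b) (add_nonneg ha hb)
  have hm := self_mem_principalIdeal (a + b) (add_nonneg ha hb)
  refine idealSpan_eq_principalIdeal (add_nonneg ha hb) (Set.union_subset ?_ ?_) fun J _ h => J.add_mem ?_ ?_
  · exact principalIdeal_le hI (hI.convex _ hm a ha (le_add_of_nonneg_right hb))
  · exact principalIdeal_le hI (hI.convex _ hm b hb (le_add_of_nonneg_left ha))
  · exact h (Or.inl (self_mem_principalIdeal a ha))
  · exact h (Or.inr (self_mem_principalIdeal b hb))

theorem idealSpan_image {H : Type*} [AddCommGroup H] [PartialOrder H] [IsOrderedAddMonoid H]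
    (f : G →+o H) (a : G) (ha : 0 ≤ a) (hfa : 0 ≤ f a) :
    idealSpan (f '' (principalIdeal a : Set G)) = principalIdeal (f a) := by
  refine idealSpan_eq_principalIdeal hfa ?_ fun J _ h => h ⟨a, self_mem_principalIdeal a ha, rfl⟩
  rintro _ ⟨x, ⟨n, h1, h2⟩, rfl⟩
  refine ⟨n, ?_, ?_⟩
  · simpa using OrderHomClass.mono f h1
  · simpa using OrderHomClass.mono f h2

variable (G) in
/-- The set of compact ideals of `G`, ordered by inclusion. -/
def CompactIdeals : Type _ := {H : AddSubgroup G // IsCompactIdeal H}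

namespace CompactIdeals

instance : PartialOrder (CompactIdeals G) :=
  inferInstanceAs (PartialOrder {H : AddSubgroup G // IsCompactIdeal H})

/-- The compact ideal `G(a)`. -/
def principal (a : G) (ha : 0 ≤ a) : CompactIdeals G :=
  ⟨principalIdeal a, isCompactIdeal_principalIdeal a ha⟩

theorem exists_eq_principal (I : CompactIdeals G) :
    ∃ (a : G) (ha : 0 ≤ a), I = principal a ha := by
  obtain ⟨a, ha, h⟩ := isCompactIdeal_iff.1 I.2
  exact ⟨a, ha, Subtype.ext h⟩

/-- The join of two compact ideals is the ideal generated by their union. -/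
instance : SemilatticeSup (CompactIdeals G) where
  sup I J := ⟨idealSpan ((I.1 : Set G) ∪ (J.1 : Set G)), by
    obtain ⟨a, ha, rfl⟩ := I.exists_eq_principal
    obtain ⟨b, hb, rfl⟩ := J.exists_eq_principal
    exact isCompactIdeal_iff.2 ⟨a + b, add_nonneg ha hb, idealSpan_union a b ha hb⟩⟩
  le_sup_left I J := fun _ hx => subset_idealSpan _ (Or.inl hx)
  le_sup_right I J := fun _ hx => subset_idealSpan _ (Or.inr hx)
  sup_le I J K hI hJ := idealSpan_le K.2.1 (Set.union_subset hI hJ)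

/-- The least compact ideal is `{0}`. -/
instance : OrderBot (CompactIdeals G) where
  bot := ⟨⊥, isCompactIdeal_iff.2 ⟨0, le_rfl, by
    ext x
    simp only [AddSubgroup.mem_bot, mem_principalIdeal, smul_zero, neg_zero, exists_const]
    exact ⟨fun h => by simp [h], fun h => le_antisymm h.2 h.1⟩⟩⟩
  bot_le I := show (⊥ : AddSubgroup G) ≤ I.1 from bot_le

theorem principal_sup (a b : G) (ha : 0 ≤ a) (hb : 0 ≤ b) :
    principal a ha ⊔ principal b hb = principal (a + b) (add_nonneg ha hb) :=
  Subtype.ext (idealSpan_union a b ha hb)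

theorem principal_zero : principal (0 : G) le_rfl = ⊥ :=
  le_bot_iff.1 (principalIdeal_le (⊥ : CompactIdeals G).2.1 (zero_mem _))

variable {H : Type*} [AddCommGroup H] [PartialOrder H] [IsOrderedAddMonoid H]

/-- A positive homomorphism sends a compact ideal `I` to the compact ideal generated by its image
`f[I]`. -/
def mapFun (f : G →+o H) (I : CompactIdeals G) : CompactIdeals H :=
  ⟨idealSpan (f '' (I.1 : Set G)), by
    obtain ⟨a, ha, rfl⟩ := I.exists_eq_principal
    exact isCompactIdeal_iff.2
      ⟨f a, map_nonneg_of_nonneg f ha, idealSpan_image f a ha (map_nonneg_of_nonneg f ha)⟩⟩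

theorem mapFun_principal (f : G →+o H) (a : G) (ha : 0 ≤ a) :
    mapFun f (principal a ha) = principal (f a) (map_nonneg_of_nonneg f ha) :=
  Subtype.ext (idealSpan_image f a ha (map_nonneg_of_nonneg f ha))

/-- The `⟨∨, 0⟩`-homomorphism induced on compact ideals by a positive homomorphism. -/
def map (f : G →+o H) : SupBotHom (CompactIdeals G) (CompactIdeals H) where
  toFun := mapFun f
  map_sup' I J := by
    obtain ⟨a, ha, rfl⟩ := I.exists_eq_principal
    obtain ⟨b, hb, rfl⟩ := J.exists_eq_principal
    simp only [principal_sup, mapFun_principal, map_add]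
  map_bot' := by
    rw [← principal_zero, mapFun_principal, ← principal_zero]
    congr 1
    exact map_zero f

end CompactIdeals

/-- An order-unit: an element `a ≥ 0` with `G(a) = G`. -/
def IsPosOrderUnit (a : G) : Prop :=
  0 ≤ a ∧ principalIdeal a = ⊤

end Ideals

/-! ### The category of partially ordered `ℚ`-vector spaces with order-unit -/

/-- A partially ordered vector space over `ℚ` with a distinguished order-unit. -/
structure OrdVect : Type (u + 1) where
  /-- the underlying set -/
  carrier : Type u
  [addCommGroup : AddCommGroup carrier]
  [partialOrder : PartialOrder carrier]
  [isOrderedAddMonoid : IsOrderedAddMonoid carrier]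
  [module : Module ℚ carrier]
  [isOrderedModule : IsOrderedModule ℚ carrier]
  /-- the distinguished order-unit -/
  unit : carrier
  isPosOrderUnit : IsPosOrderUnit unit

namespace OrdVect

instance : CoeSort OrdVect.{u} (Type u) := ⟨OrdVect.carrier⟩

attribute [instance] addCommGroup partialOrder isOrderedAddMonoid module isOrderedModule

/-- Morphisms are the positive homomorphisms, that is, the order-preserving group homomorphisms
(they are automatically `ℚ`-linear); they need not preserve the distinguished order-unit. -/
instance : LargeCategory.{u} OrdVect.{u} where
  Hom A B := A →+o B
  id A := OrderAddMonoidHom.id A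
  comp f g := g.comp f

/-- The functor that sends a partially ordered vector space to its semilattice of compact ideals,
and a positive homomorphism `f` to the map `I ↦ ideal generated by f[I]`. -/
def Idc : OrdVect.{u} ⥤ SemilatSupCat.{u} where
  obj A := SemilatSupCat.of (CompactIdeals A)
  map {A B} f := CompactIdeals.map (show A →+o B from f)
  map_id A := by
    refine SupBotHom.ext fun I => ?_
    obtain ⟨a, ha, rfl⟩ := CompactIdeals.exists_eq_principal (G := A) I
    exact CompactIdeals.mapFun_principal (OrderAddMonoidHom.id A) a ha
  map_comp {A B C} f g := by
    refine SupBotHom.ext fun I => ?_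
    obtain ⟨a, ha, rfl⟩ := CompactIdeals.exists_eq_principal (G := A) I
    change CompactIdeals.mapFun (OrderAddMonoidHom.comp (show B →+o C from g) (show A →+o B from f))
      (CompactIdeals.principal a ha) = CompactIdeals.mapFun (show B →+o C from g)
        (CompactIdeals.mapFun (show A →+o B from f) (CompactIdeals.principal a ha))
    rw [CompactIdeals.mapFun_principal, CompactIdeals.mapFun_principal,
      CompactIdeals.mapFun_principal]
    rfl

end OrdVect

/-! ### Pseudo-simplicial spaces -/

/-- The vector space `ℚ^X`, to be ordered by
`f ≤ g` iff `f = g` or `f x < g x` for all `x ∈ X`. -/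
def QStrict (X : Type u) : Type u := X → ℚ

namespace QStrict

variable {X : Type u}

instance : AddCommGroup (QStrict X) := inferInstanceAs (AddCommGroup (X → ℚ))

instance : Module ℚ (QStrict X) := inferInstanceAs (Module ℚ (X → ℚ))

instance : PartialOrder (QStrict X) where
  le f g := f = g ∨ ∀ x, f x < g x
  le_refl f := Or.inl rfl
  le_trans f g h := by
    rintro (rfl | h1) (rfl | h2)
    · exact Or.inl rfl
    · exact Or.inr h2
    · exact Or.inr h1
    · exact Or.inr fun x => (h1 x).trans (h2 x)
  le_antisymm f g := by
    rintro (rfl | h1) (h | h2)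
    · rfl
    · rfl
    · exact h.symm
    · funext x
      exact absurd (h1 x) (h2 x).asymm

theorem le_def {f g : QStrict X} : f ≤ g ↔ f = g ∨ ∀ x, f x < g x := Iff.rfl

instance : IsOrderedAddMonoid (QStrict X) where
  add_le_add_left f g h k := by
    rcases h with rfl | h
    · exact le_rfl
    · exact Or.inr fun x => add_lt_add_left (h x) (k x)

instance : IsOrderedModule ℚ (QStrict X) where
  smul_le_smul_of_nonneg_left c hc f g h := by
    rcases h with rfl | h
    · exact le_rfl
    · rcases hc.eq_or_lt with rfl | hc
      · simp
      · exact Or.inr fun x => mul_lt_mul_of_pos_left (h x) hc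
  smul_le_smul_of_nonneg_right f hf c d hcd := by
    rcases hcd.eq_or_lt with rfl | hcd
    · exact le_rfl
    · rcases hf with rfl | hf
      · simp
      · exact Or.inr fun x => mul_lt_mul_of_pos_right hcd (hf x)

/-- The constant function `1`. -/
def one (X : Type u) : QStrict X := fun _ => 1

theorem isPosOrderUnit_one (X : Type u) [Finite X] : IsPosOrderUnit (one X) := by
  refine ⟨Or.inr fun _ => zero_lt_one, eq_top_iff.2 fun f _ => ?_⟩
  cases nonempty_fintype X
  obtain ⟨n, hn⟩ := exists_nat_gt (∑ x, |(f : X → ℚ) x|)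
  have hx : ∀ x : X, |(f : X → ℚ) x| < n := fun x =>
    (Finset.single_le_sum (f := fun x => |(f : X → ℚ) x|) (fun _ _ => abs_nonneg _)
      (Finset.mem_univ x)).trans_lt hn
  have h1 : ∀ x : X, (n • one X : QStrict X) x = n := fun x => by
    change n • (1 : ℚ) = n
    simp
  refine ⟨n, Or.inr fun x => ?_, Or.inr fun x => ?_⟩
  · change -((n • one X : QStrict X) x) < f x
    rw [h1]
    exact (abs_lt.1 (hx x)).1
  · rw [h1]
    exact (abs_lt.1 (hx x)).2

end QStrict

/-- The space `ℚ_X` with its canonical order-unit, for a finite set `X`. -/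
def OrdVect.ofQStrict (X : Type u) [Finite X] : OrdVect.{u} where
  carrier := QStrict X
  unit := QStrict.one X
  isPosOrderUnit := QStrict.isPosOrderUnit_one X

/-- `A` is isomorphic to `ℚ_X`, for some nonempty finite set `X`, through an isomorphism of
partially ordered vector spaces that preserves the order-unit. -/
def OrdVect.IsSimplePseudoSimplicial (A : OrdVect.{u}) : Prop :=
  ∃ (X : Type u) (_ : Finite X) (_ : Nonempty X) (e : A ≃+o OrdVect.ofQStrict X),
    e A.unit = (OrdVect.ofQStrict X).unit

/-- `A` is, with its order-unit, a finite direct sum (with componentwise order) of simple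
pseudo-simplicial spaces. -/
def OrdVect.IsPseudoSimplicial (A : OrdVect.{u}) : Prop :=
  ∃ (n : ℕ) (B : Fin n → OrdVect.{u}),
    (∀ i, (B i).IsSimplePseudoSimplicial) ∧
      ∃ e : A ≃+o ((i : Fin n) → B i), e A.unit = fun i => (B i).unit

/-! ### Matrices lifting a finite diagram of relations -/

section MatrixLifting

/-! A homomorphism between finite Boolean semilattices is the same as a relation between their sets
of atoms: `k` is related to `l` when `l` lies below the image of `k`. Composition of homomorphisms
is composition of relations, because atoms are join-prime (`IsFiniteBoolean.le_map_iff`). On the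
other side, a nonnegative nonzero element of `ℚ_X` is strictly positive everywhere, so it generates
all of `ℚ_X`, and a compact ideal of a direct sum of such spaces is just a set of blocks
(`principalIdeal_pi_le_iff`). It remains to replace each atom `k` by a nonempty finite block of
points and each relation by a nonnegative rational matrix, functorially, so that every row `b` has a
nonzero entry in the columns of block `k` exactly when `k` is related to the block of `b`. This row
condition is what makes the matrix a positive homomorphism inducing the given relation; single
entries between related blocks may vanish.

The matrices are built by adding the doubly-irreducible elements `x` one at a time. If there are old
elements on both sides of `x`, they include a greatest element `z` below it and a least element `y`
above it, so the only real constraint is that the matrix from `z` to `y` factor through the points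
over `x` with the prescribed patterns. Since blocks may be as large as needed,
`exists_matrix_factorization` achieves this with one point over `x` for each related pair (atom at
`x`, point over `y`), plus spare points. All other maps into or out of `x` are composites through
`z` or `y` (`IsMatrixLifting.exists_insert`). -/

open Classical in
/-- A nonnegative matrix `f` whose zero pattern is a composite of two relations is a product of two
nonnegative matrices with the corresponding zero patterns. Points are pairs `(k, l)` in which `k`
is the block of the point. -/
theorem exists_matrix_factorization {κ : Type*} (R : κ → κ → Prop)
    (A B : Finset (κ × List κ)) (K : Finset κ) (f : κ × List κ → κ × List κ → ℚ≥0)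
    (hex : ∀ a ∈ A, ∀ b ∈ B, ∀ k ∈ K, R a.1 k → R k b.1 → ∃ a' ∈ A, a'.1 = a.1 ∧ f b a' ≠ 0)
    (hne : ∀ a ∈ A, ∀ b ∈ B, f b a ≠ 0 → ∃ k ∈ K, R a.1 k ∧ R k b.1) :
    ∃ (Z : Finset (κ × List κ)) (g h : κ × List κ → κ × List κ → ℚ≥0),
      (∀ z ∈ Z, z.1 ∈ K) ∧ (∀ k ∈ K, ∃ z ∈ Z, z.1 = k) ∧
      (∀ a ∈ A, ∀ b ∈ B, ∑ z ∈ Z, h b z * g z a = f b a) ∧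
      (∀ z ∈ Z, ∀ a ∈ A, (∃ a' ∈ A, a'.1 = a.1 ∧ g z a' ≠ 0) ↔ R a.1 z.1) ∧
      (∀ b ∈ B, ∀ k ∈ K, (∃ z ∈ Z, z.1 = k ∧ h b z ≠ 0) ↔ R k b.1) := by
  -- The number of intermediate blocks through which `a` is related to `b`. The entry `f b a` is
  -- shared equally among them.
  let cnt : κ × List κ → κ × List κ → ℚ≥0 := fun b a =>
    ((K.filter fun k => R a.1 k ∧ R k b.1).card : ℚ≥0)
  let h : κ × List κ → κ × List κ → ℚ≥0 := fun b z =>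
    if z.2 = b.1 :: b.2 ∧ R z.1 b.1 then 1 else 0
  let g : κ × List κ → κ × List κ → ℚ≥0 := fun z a =>
    match z with
    | (k, []) => if R a.1 k then 1 else 0
    | (k, b :: l) => if R a.1 k then f (b, l) a / cnt (b, l) a else 0
  -- A point of block `k` is tagged with the target `b` that it serves, coded as the nonempty list
  -- `b.1 :: b.2`; new points thus stay in the type `κ × List κ`. The tag `[]` marks a spare point,
  -- ignored by `h`, which keeps block `k` nonempty even if it is related to no `b`.
  let Z : Finset (κ × List κ) := K.image (fun k => (k, [])) ∪
    ((K ×ˢ B).filter fun q => R q.1 q.2.1).image fun q => (q.1, q.2.1 :: q.2.2)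
  have memZ : ∀ k l, (k, l) ∈ Z ↔ k ∈ K ∧ (l = [] ∨ ∃ b ∈ B, R k b.1 ∧ l = b.1 :: b.2) := by
    intro k l
    simp only [Z, Finset.mem_union, Finset.mem_image, Finset.mem_filter, Finset.mem_product,
      Prod.mk.injEq, Prod.exists]
    constructor
    · rintro (⟨k, hk, rfl, rfl⟩ | ⟨k, b, m, ⟨⟨hk, hb⟩, hR⟩, rfl, rfl⟩)
      · exact ⟨hk, Or.inl rfl⟩
      · exact ⟨hk, Or.inr ⟨b, m, hb, hR, rfl⟩⟩
    · rintro ⟨hk, rfl | ⟨b, m, hb, hR, rfl⟩⟩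
      · exact Or.inl ⟨k, hk, rfl, rfl⟩
      · exact Or.inr ⟨k, b, m, ⟨⟨hk, hb⟩, hR⟩, rfl, rfl⟩
  have cnt_ne : ∀ a b k, k ∈ K → R a.1 k → R k b.1 → cnt b a ≠ 0 := by
    intro a b k hk h1 h2
    exact Nat.cast_ne_zero.2 (Finset.card_ne_zero.2 ⟨k, Finset.mem_filter.2 ⟨hk, h1, h2⟩⟩)
  refine ⟨Z, g, h, ?_, ?_, ?_, ?_, ?_⟩
  · rintro ⟨k, l⟩ hz
    exact ((memZ k l).1 hz).1
  · exact fun k hk => ⟨(k, []), (memZ k []).2 ⟨hk, Or.inl rfl⟩, rfl⟩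
  · intro a ha b hb
    have e : Z.filter (fun z => z.2 = b.1 :: b.2 ∧ R z.1 b.1) =
        (K.filter fun k => R k b.1).image fun k => (k, b.1 :: b.2) := by
      ext ⟨k, l⟩
      simp only [Finset.mem_filter, memZ, Finset.mem_image, Prod.mk.injEq]
      constructor
      · rintro ⟨⟨hk, -⟩, rfl, hR⟩
        exact ⟨k, ⟨hk, hR⟩, rfl, rfl⟩
      · rintro ⟨k, ⟨hk, hR⟩, rfl, rfl⟩
        exact ⟨⟨hk, Or.inr ⟨b, hb, hR, rfl⟩⟩, rfl, hR⟩
    have e2 : ∀ z, h b z * g z a = if z.2 = b.1 :: b.2 ∧ R z.1 b.1 then g z a else 0 := by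
      intro z
      simp only [h, ite_mul, one_mul, zero_mul]
    simp only [e2]
    rw [← Finset.sum_filter, e, Finset.sum_image (fun x _ y _ hxy => (Prod.mk.inj hxy).1)]
    change ∑ k ∈ K.filter (fun k => R k b.1), (if R a.1 k then f b a / cnt b a else 0) = f b a
    rw [← Finset.sum_filter, Finset.filter_filter, Finset.sum_const, nsmul_eq_mul]
    have e3 : ((K.filter fun k => R k b.1 ∧ R a.1 k).card : ℚ≥0) = cnt b a := by
      simp only [cnt, and_comm]
    rw [e3]
    -- When `cnt b a = 0` the division is void, but then `hne` forces `f b a = 0`.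
    by_cases h0 : f b a = 0
    · simp [h0]
    · obtain ⟨k, hk, h1, h2⟩ := hne a ha b hb h0
      exact mul_div_cancel₀ _ (cnt_ne a b k hk h1 h2)
  · rintro ⟨k, l⟩ hz a ha
    obtain ⟨hk, rfl | ⟨b, hb, hR, rfl⟩⟩ := (memZ k l).1 hz
    · constructor
      · rintro ⟨a', -, h1, h2⟩
        by_contra hc
        exact h2 (if_neg (by rwa [h1]))
      · exact fun hR => ⟨a, ha, rfl, by simp [g, hR]⟩
    · constructor
      · rintro ⟨a', -, h1, h2⟩
        by_contra hc
        exact h2 (if_neg (by rwa [h1]))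
      -- The entry of `g` at `a` itself may vanish with `f b a`; `hex` supplies another column of
      -- the same block where it does not.
      · intro hR'
        obtain ⟨a', ha', h1, h2⟩ := hex a ha b hb k hk hR' hR
        refine ⟨a', ha', h1, ?_⟩
        have hR1 : R a'.1 k := by rwa [h1]
        change (if R a'.1 k then f b a' / cnt b a' else 0) ≠ 0
        rw [if_pos hR1]
        exact div_ne_zero h2 (cnt_ne a' b k hk hR1 hR)
  · intro b hb k hk
    constructor
    · rintro ⟨⟨k', l⟩, -, rfl, h2⟩
      by_contra hc
      exact h2 (if_neg fun h => hc h.2)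
    · intro hR
      exact ⟨(k, b.1 :: b.2), (memZ _ _).2 ⟨hk, Or.inr ⟨b, hb, hR, rfl⟩⟩, rfl, by simp [h, hR]⟩

/-! ### Relation diagrams and the inductive construction of their matrix liftings. -/

variable {P : Type w} [PartialOrder P] {κ : Type*}

/-- A relation `R` on the disjoint union `κ` of sets indexed by `P` (with projection `p`) that
is a functor from `P` to sets and relations. -/
structure IsRelationDiagram (p : κ → P) (R : κ → κ → Prop) : Prop where
  iff_eq : ∀ k l, p k = p l → (R k l ↔ k = l)
  iff_exists : ∀ k m y, p k ≤ y → y ≤ p m → (R k m ↔ ∃ l, p l = y ∧ R k l ∧ R l m)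

open Classical in
/-- Over the subset `c` of `P`, the matrix `M` on the set `N` of points is a functor
whose zero pattern is given by `R`. -/
structure IsMatrixLifting (p : κ → P) (R : κ → κ → Prop) (c : Set P)
    (N : Finset (κ × List κ)) (M : κ × List κ → κ × List κ → ℚ≥0) : Prop where
  mem : ∀ a ∈ N, p a.1 ∈ c
  surj : ∀ k, p k ∈ c → ∃ a ∈ N, a.1 = k
  one : ∀ a ∈ N, ∀ b ∈ N, p a.1 = p b.1 → M b a = if a = b then 1 else 0
  mul : ∀ a ∈ N, ∀ b ∈ N, ∀ y ∈ c, p a.1 ≤ y → y ≤ p b.1 →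
    ∑ m ∈ N with p m.1 = y, M b m * M m a = M b a
  supp : ∀ b ∈ N, ∀ k, p k ∈ c → p k ≤ p b.1 → ((∃ a ∈ N, a.1 = k ∧ M b a ≠ 0) ↔ R k b.1)

open Classical in
/-- A matrix lifting extends to one more point `x` of the poset if the elements above `x` have a
least element, if any, and the elements below `x` have a greatest element, if any. -/
theorem IsMatrixLifting.exists_insert [Finite κ] {p : κ → P} {R : κ → κ → Prop}
    (hR : IsRelationDiagram p R) {c : Set P} {N : Finset (κ × List κ)}
    {M : κ × List κ → κ × List κ → ℚ≥0} (hM : IsMatrixLifting p R c N M) {x : P} (hx : x ∉ c)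
    (hlow : ∀ q ∈ c, q < x → ∃ z ∈ c, z < x ∧ ∀ q ∈ c, q < x → q ≤ z)
    (hupp : ∀ q ∈ c, x < q → ∃ y ∈ c, x < y ∧ ∀ q ∈ c, x < q → y ≤ q) :
    ∃ N' M', IsMatrixLifting p R (insert x c) N' M' := by
  have := Fintype.ofFinite κ
  -- `A` consists of the points over the greatest element of `c` below `x`, `B` of those over the
  -- least element above `x`. Either set is empty when no such element exists, so no case
  -- distinction is needed.
  let A := N.filter fun a => p a.1 < x ∧ ∀ q ∈ c, q < x → q ≤ p a.1
  let B := N.filter fun b => x < p b.1 ∧ ∀ q ∈ c, x < q → p b.1 ≤ q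
  let K : Finset κ := Finset.univ.filter fun k => p k = x
  have memK : ∀ k, k ∈ K ↔ p k = x := fun k => by simp [K]
  have hA : ∀ q ∈ c, q < x → ∃ z ∈ c, z < x ∧ q ≤ z ∧ A = N.filter fun a => p a.1 = z := by
    intro q hq hqx
    obtain ⟨z, hz, hzx, h⟩ := hlow q hq hqx
    refine ⟨z, hz, hzx, h q hq hqx, Finset.filter_congr fun a ha => ⟨fun h1 => ?_, ?_⟩⟩
    · exact le_antisymm (h _ (hM.mem a ha) h1.1) (h1.2 z hz hzx)
    · intro h1
      rw [h1]
      exact ⟨hzx, h⟩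
  have hB : ∀ q ∈ c, x < q → ∃ y ∈ c, x < y ∧ y ≤ q ∧ B = N.filter fun a => p a.1 = y := by
    intro q hq hqx
    obtain ⟨z, hz, hzx, h⟩ := hupp q hq hqx
    refine ⟨z, hz, hzx, h q hq hqx, Finset.filter_congr fun a ha => ⟨fun h1 => ?_, ?_⟩⟩
    · exact le_antisymm (h1.2 z hz hzx) (h _ (hM.mem a ha) h1.1)
    · intro h1
      rw [h1]
      exact ⟨hzx, h⟩
  have hAN : ∀ a ∈ A, a ∈ N := fun a ha => (Finset.mem_filter.1 ha).1
  have hBN : ∀ a ∈ B, a ∈ N := fun a ha => (Finset.mem_filter.1 ha).1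
  have hAx : ∀ a ∈ A, p a.1 < x := fun a ha => (Finset.mem_filter.1 ha).2.1
  have hBx : ∀ a ∈ B, x < p a.1 := fun a ha => (Finset.mem_filter.1 ha).2.1
  have hAfull : ∀ a ∈ A, ∀ a' ∈ N, a'.1 = a.1 → a' ∈ A := fun a ha a' ha' h =>
    Finset.mem_filter.2 ⟨ha', by rw [h]; exact (Finset.mem_filter.1 ha).2⟩
  obtain ⟨Z, g, h, hZK, hKZ, hgh, hg, hh⟩ := exists_matrix_factorization R A B K M
    (by
      intro a ha b hb k hk h1 h2
      have hab : p a.1 ≤ p b.1 := ((hAx a ha).trans (hBx b hb)).le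
      have := (hR.iff_exists a.1 b.1 x (hAx a ha).le (hBx b hb).le).2 ⟨k, (memK k).1 hk, h1, h2⟩
      obtain ⟨a', h3, h4, h5⟩ := (hM.supp b (hBN b hb) a.1 (hM.mem a (hAN a ha)) hab).2 this
      exact ⟨a', hAfull a ha a' h3 h4, h4, h5⟩)
    (by
      intro a ha b hb h1
      have hab : p a.1 ≤ p b.1 := ((hAx a ha).trans (hBx b hb)).le
      have := (hM.supp b (hBN b hb) a.1 (hM.mem a (hAN a ha)) hab).1 ⟨a, hAN a ha, rfl, h1⟩
      obtain ⟨k, h1, h2⟩ := (hR.iff_exists a.1 b.1 x (hAx a ha).le (hBx b hb).le).1 this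
      exact ⟨k, (memK k).2 h1, h2⟩)
  have hZx : ∀ z ∈ Z, p z.1 = x := fun z hz => (memK _).1 (hZK z hz)
  have hNx : ∀ a ∈ N, p a.1 ≠ x := fun a ha e => hx (e ▸ hM.mem a ha)
  -- Maps out of `x` pass through `B`, maps into `x` through `A`. Entries between points over
  -- incomparable elements are arbitrary, since `IsMatrixLifting` does not constrain them.
  let M' : κ × List κ → κ × List κ → ℚ≥0 := fun b a =>
    if p a.1 = x then if p b.1 = x then if a = b then 1 else 0 else ∑ m ∈ B, M b m * h m a
    else if p b.1 = x then ∑ m ∈ A, g b m * M m a else M b a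
  have M'ZZ : ∀ a ∈ Z, ∀ b ∈ Z, M' b a = if a = b then 1 else 0 := fun a ha b hb => by
    simp only [M', hZx a ha, hZx b hb, if_true]
  have M'NZ : ∀ a ∈ Z, ∀ b ∈ N, M' b a = ∑ m ∈ B, M b m * h m a := fun a ha b hb => by
    simp only [M', hZx a ha, hNx b hb, if_true, if_false]
  have M'ZN : ∀ a ∈ N, ∀ b ∈ Z, M' b a = ∑ m ∈ A, g b m * M m a := fun a ha b hb => by
    simp only [M', hNx a ha, hZx b hb, if_true, if_false]
  have M'NN : ∀ a ∈ N, ∀ b ∈ N, M' b a = M b a := fun a ha b hb => by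
    simp only [M', hNx a ha, hNx b hb, if_false]
  have filx : (N ∪ Z).filter (fun m => p m.1 = x) = Z := by
    rw [Finset.filter_union, Finset.filter_false_of_mem hNx, Finset.filter_true_of_mem hZx,
      Finset.empty_union]
  have filc : ∀ y ∈ c, (N ∪ Z).filter (fun m => p m.1 = y) = N.filter fun m => p m.1 = y := by
    intro y hy
    rw [Finset.filter_union, Finset.filter_false_of_mem (s := Z), Finset.union_empty]
    rintro z hz rfl
    exact hx (hZx z hz ▸ hy)
  refine ⟨N ∪ Z, M', ?_, ?_, ?_, ?_, ?_⟩
  · intro a ha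
    rcases Finset.mem_union.1 ha with ha | ha
    · exact Or.inr (hM.mem a ha)
    · exact Or.inl (hZx a ha)
  · rintro k (hk | hk)
    · obtain ⟨z, hz, h1⟩ := hKZ k ((memK k).2 hk)
      exact ⟨z, Finset.mem_union_right _ hz, h1⟩
    · obtain ⟨z, hz, h1⟩ := hM.surj k hk
      exact ⟨z, Finset.mem_union_left _ hz, h1⟩
  · intro a ha b hb hab
    rcases Finset.mem_union.1 ha with ha | ha <;> rcases Finset.mem_union.1 hb with hb | hb
    · rw [M'NN a ha b hb, hM.one a ha b hb hab]
    · exact absurd (hab.trans (hZx b hb)) (hNx a ha)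
    · exact absurd (hab.symm.trans (hZx a ha)) (hNx b hb)
    · rw [M'ZZ a ha b hb]
  · intro a ha b hb y hy hay hyb
    rcases hy with rfl | hy
    · rw [filx]
      rcases Finset.mem_union.1 ha with ha | ha
      · rcases Finset.mem_union.1 hb with hb | hb
        · have hay' := lt_of_le_of_ne hay (hNx a ha)
          have hyb' := lt_of_le_of_ne hyb (hNx b hb).symm
          obtain ⟨z, hz, hzx, haz, eA⟩ := hA _ (hM.mem a ha) hay'
          obtain ⟨y', hy', hxy, hyb'', eB⟩ := hB _ (hM.mem b hb) hyb'
          rw [M'NN a ha b hb]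
          -- The path from `a` through `z`, `x`, `y'` to `b` contracts: `h * g` is the old matrix
          -- from `z` to `y'`, and functoriality of `M` removes `z` and then `y'`.
          calc ∑ m ∈ Z, M' b m * M' m a
              = ∑ m ∈ Z, ∑ n ∈ B, ∑ l ∈ A, M b n * (h n m * g m l) * M l a := by
                refine Finset.sum_congr rfl fun m hm => ?_
                rw [M'NZ m hm b hb, M'ZN a ha m hm, Finset.sum_mul_sum]
                exact Finset.sum_congr rfl fun n _ => Finset.sum_congr rfl fun l _ => by ring
            _ = ∑ n ∈ B, ∑ l ∈ A, M b n * (∑ m ∈ Z, h n m * g m l) * M l a := by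
                rw [Finset.sum_comm]
                refine Finset.sum_congr rfl fun n _ => ?_
                rw [Finset.sum_comm]
                refine Finset.sum_congr rfl fun l _ => ?_
                rw [Finset.mul_sum, Finset.sum_mul]
            _ = ∑ n ∈ B, M b n * M n a := by
                refine Finset.sum_congr rfl fun n hn => ?_
                have hn' : y' = p n.1 := by rw [eB] at hn; exact (Finset.mem_filter.1 hn).2.symm
                rw [← hM.mul a ha n (hBN n hn) z hz haz (hn' ▸ (hzx.trans hxy).le), ← eA,
                  Finset.mul_sum]
                refine Finset.sum_congr rfl fun l hl => ?_
                rw [hgh l hl n hn, mul_assoc]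
            _ = M b a := by
                rw [eB]
                exact hM.mul a ha b hb y' hy' (hay'.trans hxy).le hyb''
        · rw [Finset.sum_eq_single b]
          · rw [M'ZZ b hb b hb, if_pos rfl, one_mul]
          · intro m hm hmb
            rw [M'ZZ m hm b hb, if_neg hmb, zero_mul]
          · exact fun hb' => absurd hb hb'
      · rw [Finset.sum_eq_single a]
        · rw [M'ZZ a ha a ha, if_pos rfl, mul_one]
        · intro m hm hma
          rw [M'ZZ a ha m hm, if_neg hma.symm, mul_zero]
        · exact fun ha' => absurd ha ha'
    · rw [filc y hy]
      have hyx : y ≠ x := fun e => hx (e ▸ hy)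
      have hmN : ∀ m ∈ N.filter (fun m => p m.1 = y), m ∈ N := fun m hm =>
        (Finset.mem_filter.1 hm).1
      have hmy : ∀ m ∈ N.filter (fun m => p m.1 = y), p m.1 = y := fun m hm =>
        (Finset.mem_filter.1 hm).2
      rcases Finset.mem_union.1 ha with ha | ha <;> rcases Finset.mem_union.1 hb with hb | hb
      · rw [M'NN a ha b hb, ← hM.mul a ha b hb y hy hay hyb]
        refine Finset.sum_congr rfl fun m hm => ?_
        rw [M'NN m (hmN m hm) b hb, M'NN a ha m (hmN m hm)]
      · rw [hZx b hb] at hyb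
        obtain ⟨z, hz, hzx, hyz, eA⟩ := hA y hy (lt_of_le_of_ne hyb hyx)
        rw [M'ZN a ha b hb]
        calc ∑ m ∈ N with p m.1 = y, M' b m * M' m a
            = ∑ m ∈ N with p m.1 = y, ∑ l ∈ A, g b l * (M l m * M m a) := by
              refine Finset.sum_congr rfl fun m hm => ?_
              rw [M'ZN m (hmN m hm) b hb, M'NN a ha m (hmN m hm), Finset.sum_mul]
              exact Finset.sum_congr rfl fun l _ => mul_assoc _ _ _
          _ = ∑ l ∈ A, g b l * M l a := by
              rw [Finset.sum_comm]
              refine Finset.sum_congr rfl fun l hl => ?_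
              have hl' : p l.1 = z := by rw [eA] at hl; exact (Finset.mem_filter.1 hl).2
              rw [← Finset.mul_sum, hM.mul a ha l (hAN l hl) y hy hay (hl' ▸ hyz)]
      · rw [hZx a ha] at hay
        obtain ⟨z, hz, hzx, hzy, eB⟩ := hB y hy (lt_of_le_of_ne hay hyx.symm)
        rw [M'NZ a ha b hb]
        calc ∑ m ∈ N with p m.1 = y, M' b m * M' m a
            = ∑ m ∈ N with p m.1 = y, ∑ l ∈ B, M b m * M m l * h l a := by
              refine Finset.sum_congr rfl fun m hm => ?_
              rw [M'NZ a ha m (hmN m hm), M'NN m (hmN m hm) b hb, Finset.mul_sum]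
              exact Finset.sum_congr rfl fun l _ => (mul_assoc _ _ _).symm
          _ = ∑ l ∈ B, M b l * h l a := by
              rw [Finset.sum_comm]
              refine Finset.sum_congr rfl fun l hl => ?_
              have hl' : p l.1 = z := by rw [eB] at hl; exact (Finset.mem_filter.1 hl).2
              rw [← Finset.sum_mul, hM.mul l (hBN l hl) b hb y hy (hl' ▸ hzy) hyb]
      · exact absurd (le_antisymm (hyb.trans (hZx b hb).le) ((hZx a ha).ge.trans hay)) hyx
  · intro b hb k hk hkb
    have sum_ne : ∀ (s : Finset (κ × List κ)) (f : κ × List κ → ℚ≥0),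
        ∑ m ∈ s, f m ≠ 0 ↔ ∃ m ∈ s, f m ≠ 0 := fun s f => by
      simp [Finset.sum_eq_zero_iff]
    rcases hk with hk | hk <;> rcases Finset.mem_union.1 hb with hb | hb
    · have hxb : x < p b.1 := lt_of_le_of_ne (hk ▸ hkb) (hNx b hb).symm
      obtain ⟨y, hy, hxy, hyb, eB⟩ := hB _ (hM.mem b hb) hxb
      have hBy : ∀ m ∈ B, p m.1 = y := fun m hm => by
        rw [eB] at hm; exact (Finset.mem_filter.1 hm).2
      constructor
      · rintro ⟨a, ha, rfl, h1⟩
        have haZ : a ∈ Z := (Finset.mem_union.1 ha).resolve_left fun h => hNx a h hk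
        rw [M'NZ a haZ b hb, sum_ne] at h1
        obtain ⟨m, hm, h1⟩ := h1
        have hmy := hBy m hm
        refine (hR.iff_exists a.1 b.1 y (hk.le.trans hxy.le) hyb).2 ⟨m.1, hmy, ?_, ?_⟩
        · exact (hh m hm a.1 ((memK _).2 hk)).1 ⟨a, haZ, rfl, right_ne_zero_of_mul h1⟩
        · exact (hM.supp b hb m.1 (hmy ▸ hy) (hmy ▸ hyb)).1
            ⟨m, hBN m hm, rfl, left_ne_zero_of_mul h1⟩
      · intro h1
        obtain ⟨l, hl, h2, h3⟩ := (hR.iff_exists k b.1 y (hk.le.trans hxy.le) hyb).1 h1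
        obtain ⟨m, hm, rfl, h4⟩ := (hM.supp b hb l (hl ▸ hy) (hl ▸ hyb)).2 h3
        have hmB : m ∈ B := by rw [eB]; exact Finset.mem_filter.2 ⟨hm, hl⟩
        obtain ⟨a, ha, rfl, h5⟩ := (hh m hmB k ((memK _).2 hk)).2 h2
        refine ⟨a, Finset.mem_union_right _ ha, rfl, ?_⟩
        rw [M'NZ a ha b hb, sum_ne]
        exact ⟨m, hmB, mul_ne_zero h4 h5⟩
    · rw [hR.iff_eq k b.1 (hk.trans (hZx b hb).symm)]
      constructor
      · rintro ⟨a, ha, rfl, h1⟩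
        have haZ : a ∈ Z := (Finset.mem_union.1 ha).resolve_left fun h => hNx a h hk
        rw [M'ZZ a haZ b hb] at h1
        by_contra hc
        exact h1 (if_neg fun e => hc (by rw [e]))
      · rintro rfl
        exact ⟨b, Finset.mem_union_right _ hb, rfl, by rw [M'ZZ b hb b hb]; simp⟩
    · rw [← hM.supp b hb k hk hkb]
      constructor
      · rintro ⟨a, ha, rfl, h1⟩
        have haN : a ∈ N := (Finset.mem_union.1 ha).resolve_right fun h => hx (hZx a h ▸ hk)
        exact ⟨a, haN, rfl, by rwa [← M'NN a haN b hb]⟩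
      · rintro ⟨a, ha, rfl, h1⟩
        exact ⟨a, Finset.mem_union_left _ ha, rfl, by rwa [M'NN a ha b hb]⟩
    · have hkx : p k < x := lt_of_le_of_ne (hZx b hb ▸ hkb) fun e => hx (e ▸ hk)
      obtain ⟨z, hz, hzx, hkz, eA⟩ := hA _ hk hkx
      have hAz : ∀ m ∈ A, p m.1 = z := fun m hm => by
        rw [eA] at hm; exact (Finset.mem_filter.1 hm).2
      have hzb : z ≤ p b.1 := hzx.le.trans (hZx b hb).ge
      constructor
      · rintro ⟨a, ha, rfl, h1⟩
        have haN : a ∈ N := (Finset.mem_union.1 ha).resolve_right fun h => hx (hZx a h ▸ hk)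
        rw [M'ZN a haN b hb, sum_ne] at h1
        obtain ⟨m, hm, h1⟩ := h1
        have hmz := hAz m hm
        refine (hR.iff_exists a.1 b.1 z hkz hzb).2 ⟨m.1, hmz, ?_, ?_⟩
        · exact (hM.supp m (hAN m hm) a.1 hk (hmz ▸ hkz)).1
            ⟨a, haN, rfl, right_ne_zero_of_mul h1⟩
        · exact (hg b hb m hm).1 ⟨m, hm, rfl, left_ne_zero_of_mul h1⟩
      · intro h1
        obtain ⟨l, hl, h2, h3⟩ := (hR.iff_exists k b.1 z hkz hzb).1 h1
        -- Any point of block `l` gives access to `hg`, which may return a different point `m` of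
        -- that block. This is harmless because the pattern of a row depends only on its block.
        obtain ⟨m₀, hm₀, rfl⟩ := hM.surj l (hl ▸ hz)
        obtain ⟨m, hm, h4, h5⟩ := (hg b hb m₀ (by rw [eA]; exact Finset.mem_filter.2 ⟨hm₀, hl⟩)).2 h3
        rw [← h4] at h2
        obtain ⟨a, ha, rfl, h6⟩ := (hM.supp m (hAN m hm) k hk ((hAz m hm).symm ▸ hkz)).2 h2
        refine ⟨a, Finset.mem_union_left _ ha, rfl, ?_⟩
        rw [M'ZN a ha b hb, sum_ne]
        exact ⟨m, hm, mul_ne_zero h5 h6⟩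

/-- Every finite relation diagram over a dismantlable finite poset has a matrix lifting. -/
theorem IsDismantlable.exists_isMatrixLifting [Finite P] (hP : IsDismantlable P) [Finite κ]
    {p : κ → P} {R : κ → κ → Prop} (hR : IsRelationDiagram p R) :
    ∃ N M, IsMatrixLifting p R Set.univ N M := by
  obtain ⟨c, h0, h1, hc⟩ := hP
  suffices ∀ i ≤ Nat.card P, ∃ N M, IsMatrixLifting p R (c i) N M by
    rw [← h1]
    exact this _ le_rfl
  intro i
  induction i with
  | zero =>
    intro _
    refine ⟨∅, 0, ?_⟩
    rw [h0]
    constructor <;> simp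
  | succ i ih =>
    intro hi
    obtain ⟨N, M, hM⟩ := ih (Nat.le_of_succ_le hi)
    obtain ⟨x, ⟨hup, hlow⟩, hx⟩ := hc i hi
    have hins : c (i + 1) = insert (x : P) (c i) := by
      rw [hx, Set.insert_sdiff_singleton, Set.insert_eq_of_mem x.2]
    have hsub : ∀ q ∈ c i, q ∈ c (i + 1) := fun q hq => hins ▸ Or.inr hq
    have hback : ∀ q : c (i + 1), q ≠ x → (q : P) ∈ c i := fun q hq => by
      rw [hx]
      exact ⟨q.2, fun e => hq (Subtype.ext e)⟩
    rw [hins]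
    refine hM.exists_insert hR (by simp [hx]) ?_ ?_
    · intro q hq hqx
      -- In the finite poset `c (i + 1)` every element below `x` lies below a lower cover of `x`. As
      -- there is at most one, it is the greatest element below `x`.
      obtain ⟨z, -, hz⟩ := exists_le_covBy_of_lt (show (⟨q, hsub q hq⟩ : c (i + 1)) < x from hqx)
      refine ⟨z, hback z hz.lt.ne, hz.lt, fun r hr hrx => ?_⟩
      obtain ⟨z', h, hz'⟩ :=
        exists_le_covBy_of_lt (show (⟨r, hsub r hr⟩ : c (i + 1)) < x from hrx)
      exact hlow hz hz' ▸ h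
    · intro q hq hqx
      obtain ⟨z, hz, -⟩ := exists_covBy_le_of_lt (show x < (⟨q, hsub q hq⟩ : c (i + 1)) from hqx)
      refine ⟨z, hback z hz.lt.ne', hz.lt, fun r hr hrx => ?_⟩
      obtain ⟨z', hz', h⟩ :=
        exists_covBy_le_of_lt (show x < (⟨r, hsub r hr⟩ : c (i + 1)) from hrx)
      exact hup hz hz' ▸ h

end MatrixLifting

/-! ### From points to families of blocks. -/

/-- The matrices of a lifting, for a diagram of relations between finite sets `K x`; the rows and
columns are indexed by disjoint unions of nonempty blocks. -/
theorem IsDismantlable.exists_blockMatrices {P : Type w} [PartialOrder P] [Finite P]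
    (hP : IsDismantlable P) (K : P → Type u) [∀ x, Finite (K x)]
    (R : ∀ x y, K x → K y → Prop) (hid : ∀ x k l, R x x k l ↔ k = l)
    (hcomp : ∀ x y z, x ≤ y → y ≤ z → ∀ k m, R x z k m ↔ ∃ l, R x y k l ∧ R y z l m) :
    ∃ (X : ∀ x, K x → Type u) (_ : ∀ x k, Finite (X x k)) (_ : ∀ x k, Nonempty (X x k))
      (M : ∀ x y, (Σ l, X y l) → (Σ k, X x k) → ℚ≥0),
      (∀ x a, M x x a a = 1) ∧ (∀ x a b, a ≠ b → M x x b a = 0) ∧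
      (∀ x y z, x ≤ y → y ≤ z → ∀ a b, ∑ᶠ m, M y z b m * M x y m a = M x z b a) ∧
      (∀ x y, x ≤ y → ∀ b k, (∃ a, M x y b ⟨k, a⟩ ≠ 0) ↔ R x y k b.1) := by
  classical
  -- Numbering all indices by `Fin n` removes the universe of `P`, so that the blocks can be lifted
  -- to `Type u`.
  obtain ⟨n, ⟨e⟩⟩ := Finite.exists_equiv_fin (Σ x, K x)
  have hR : IsRelationDiagram (fun j => (e.symm j).1)
      (fun i j => R _ _ (e.symm i).2 (e.symm j).2) := by
    constructor
    · intro i j h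
      rw [← e.symm.injective.eq_iff]
      generalize e.symm i = k at *
      generalize e.symm j = l at *
      obtain ⟨x, k⟩ := k
      obtain ⟨y, l⟩ := l
      obtain rfl : x = y := h
      simp [hid]
    · intro i j y h1 h2
      rw [hcomp _ y _ h1 h2]
      constructor
      · rintro ⟨l, h3, h4⟩
        refine ⟨e ⟨y, l⟩, by simp, ?_⟩
        rw [e.symm_apply_apply]
        exact ⟨h3, h4⟩
      · rintro ⟨l, rfl, h3⟩
        exact ⟨_, h3⟩
  obtain ⟨N, M, hM⟩ := hP.exists_isMatrixLifting hR
  let X : ∀ x, K x → Type u := fun x k => ULift.{u} {a // a ∈ N ∧ a.1 = e ⟨x, k⟩}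
  have hfin : ∀ x k, Finite (X x k) := fun x k => by
    have : Finite {a // a ∈ N ∧ a.1 = e ⟨x, k⟩} :=
      (N.finite_toSet.subset fun a (ha : a ∈ N ∧ _) => ha.1).to_subtype
    infer_instance
  let pt : ∀ x, (Σ k, X x k) → Fin n × List (Fin n) := fun x a => a.2.down.1
  have ptN : ∀ x a, pt x a ∈ N := fun x a => a.2.down.2.1
  have pt1 : ∀ x a, (pt x a).1 = e ⟨x, a.1⟩ := fun x a => a.2.down.2.2
  have ptp : ∀ x a, (e.symm (pt x a).1).1 = x := fun x a => by rw [pt1, e.symm_apply_apply]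
  have pt_inj : ∀ x, Function.Injective (pt x) := by
    rintro x ⟨k, ⟨⟨a, ha, ha1⟩⟩⟩ ⟨l, ⟨⟨b, hb, hb1⟩⟩⟩ hab
    obtain rfl : a = b := hab
    have := e.injective (ha1.symm.trans hb1)
    simp only [Sigma.mk.injEq, heq_eq_eq, true_and] at this
    subst this
    rfl
  have pt_surj : ∀ x, ∀ a ∈ N, (e.symm a.1).1 = x → ∃ a', pt x a' = a := by
    rintro x a ha rfl
    exact ⟨⟨(e.symm a.1).2, ⟨⟨a, ha, by simp⟩⟩⟩, rfl⟩
  refine ⟨X, hfin, ?_, fun x y b a => M (pt y b) (pt x a), ?_, ?_, ?_, ?_⟩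
  · intro x k
    obtain ⟨a, ha, h⟩ := hM.surj (e ⟨x, k⟩) trivial
    exact ⟨⟨⟨a, ha, h⟩⟩⟩
  · intro x a
    beta_reduce
    rw [hM.one _ (ptN x a) _ (ptN x a) rfl, if_pos rfl]
  · intro x a b hab
    beta_reduce
    rw [hM.one _ (ptN x a) _ (ptN x b) (by rw [ptp, ptp]), if_neg fun h => hab (pt_inj x h)]
  · intro x y z hxy hyz a b
    beta_reduce
    rw [← hM.mul _ (ptN x a) _ (ptN z b) y trivial (by rwa [ptp]) (by rwa [ptp])]
    have := Fintype.ofFinite (Σ k, X y k)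
    rw [finsum_eq_sum_of_fintype]
    refine Finset.sum_nbij (pt y) ?_ ((pt_inj y).injOn) ?_ fun _ _ => rfl
    · intro m _
      exact Finset.mem_filter.2 ⟨ptN y m, ptp y m⟩
    · intro m hm
      obtain ⟨h1, h2⟩ := Finset.mem_filter.1 hm
      obtain ⟨m', h⟩ := pt_surj y m h1 h2
      exact ⟨m', by simp, h⟩
  · intro x y hxy b k
    have h := hM.supp _ (ptN y b) (e ⟨x, k⟩) trivial (by rw [ptp]; simpa using hxy)
    rw [show R _ _ (e.symm (e ⟨x, k⟩)).2 (e.symm (pt y b).1).2 ↔ R x y k b.1 by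
      rw [pt1, e.symm_apply_apply, e.symm_apply_apply]] at h
    rw [← h]
    constructor
    · rintro ⟨a, ha⟩
      exact ⟨_, ptN x ⟨k, a⟩, pt1 x ⟨k, a⟩, ha⟩
    · rintro ⟨a, ha, h1, h2⟩
      exact ⟨⟨⟨a, ha, h1⟩⟩, h2⟩

/-! ### Direct sums of the spaces `ℚ_X` -/

section BlockSpace

/-- A nonzero `b ≥ 0` is strictly positive on the finite set `X`, hence an order-unit. Asking for
all large `n` lets finitely many blocks share one multiple. -/
theorem QStrict.eventually_mem_Icc {X : Type u} [Finite X] {a b : QStrict X} (hb : 0 ≤ b)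
    (h : b = 0 → a = 0) : ∀ᶠ n : ℕ in Filter.atTop, -(n • b) ≤ a ∧ a ≤ n • b := by
  rcases hb with hb | hb
  · rw [h hb.symm, ← hb]
    simp
  · have key : ∀ᶠ n : ℕ in Filter.atTop, ∀ x, |(a : X → ℚ) x| < n * (b : X → ℚ) x := by
      refine Filter.eventually_all.2 fun x => ?_
      have hx : 0 < (b : X → ℚ) x := hb x
      obtain ⟨m, hm⟩ := exists_nat_gt (|(a : X → ℚ) x| / (b : X → ℚ) x)
      filter_upwards [Filter.eventually_ge_atTop m] with n hn
      rw [← div_lt_iff₀ hx]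
      exact hm.trans_le (by exact_mod_cast hn)
    filter_upwards [key] with n hn
    have e : ∀ x, (n • b : QStrict X) x = n * (b : X → ℚ) x := fun x => nsmul_eq_mul _ _
    refine ⟨Or.inr fun x => ?_, Or.inr fun x => ?_⟩
    · change -((n • b : QStrict X) x) < a x
      rw [e]
      exact (abs_lt.1 (hn x)).1
    · rw [e]
      exact (abs_lt.1 (hn x)).2

variable {K : Type*} {X : K → Type u}

theorem mem_principalIdeal_pi [Finite K] [∀ k, Finite (X k)] {b : ∀ k, QStrict (X k)} (hb : 0 ≤ b)
    {a : ∀ k, QStrict (X k)} : a ∈ principalIdeal b ↔ ∀ k, b k = 0 → a k = 0 := by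
  constructor
  · rintro ⟨n, h1, h2⟩ k hk
    have h1 := h1 k
    have h2 := h2 k
    simp only [Pi.neg_apply, Pi.smul_apply, hk, smul_zero, neg_zero] at h1 h2
    exact le_antisymm h2 h1
  · intro h
    obtain ⟨n, hn⟩ := (Filter.eventually_all.2 fun k =>
      QStrict.eventually_mem_Icc (hb k) (h k)).exists
    exact ⟨n, fun k => (hn k).1, fun k => (hn k).2⟩

theorem principalIdeal_pi_le_iff [Finite K] [∀ k, Finite (X k)] {a b : ∀ k, QStrict (X k)}
    (ha : 0 ≤ a) (hb : 0 ≤ b) :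
    principalIdeal a ≤ principalIdeal b ↔ ∀ k, b k = 0 → a k = 0 := by
  rw [← mem_principalIdeal_pi hb]
  exact ⟨fun h => h (self_mem_principalIdeal a ha),
    principalIdeal_le (isOrderIdeal_principalIdeal b hb)⟩

theorem principal_pi_eq_iff [Finite K] [∀ k, Finite (X k)] {a b : ∀ k, QStrict (X k)}
    (ha : 0 ≤ a) (hb : 0 ≤ b) :
    CompactIdeals.principal a ha = CompactIdeals.principal b hb ↔ ∀ k, a k = 0 ↔ b k = 0 := by
  have h1 : CompactIdeals.principal a ha ≤ CompactIdeals.principal b hb ↔ _ :=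
    principalIdeal_pi_le_iff ha hb
  have h2 : CompactIdeals.principal b hb ≤ CompactIdeals.principal a ha ↔ _ :=
    principalIdeal_pi_le_iff hb ha
  rw [le_antisymm_iff, h1, h2, ← forall_and]
  exact forall_congr' fun k => ⟨fun h => ⟨h.2, h.1⟩, fun h => ⟨h.2, h.1⟩⟩

/-- The direct sum of the spaces `ℚ_(X k)`. -/
def OrdVect.block {K : Type u} [Finite K] (X : K → Type u) [∀ k, Finite (X k)] :
    OrdVect.{u} where
  carrier := ∀ k, QStrict (X k)
  isOrderedModule :=
    { smul_le_smul_of_nonneg_left := fun _ hc _ _ h k => smul_le_smul_of_nonneg_left (h k) hc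
      smul_le_smul_of_nonneg_right := fun _ hf _ _ h k => smul_le_smul_of_nonneg_right h (hf k) }
  unit := fun k => QStrict.one (X k)
  isPosOrderUnit := by
    have h0 : (0 : ∀ k, QStrict (X k)) ≤ fun k => QStrict.one (X k) :=
      fun k => (QStrict.isPosOrderUnit_one (X k)).1
    refine ⟨h0, eq_top_iff.2 fun a _ => (mem_principalIdeal_pi h0).2 fun k hk => ?_⟩
    funext x
    exact absurd (congrFun hk x) one_ne_zero

theorem OrdVect.block_isPseudoSimplicial {K : Type u} [Finite K] (X : K → Type u)
    [∀ k, Finite (X k)] [∀ k, Nonempty (X k)] : (OrdVect.block X).IsPseudoSimplicial := by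
  obtain ⟨n, ⟨e⟩⟩ := Finite.exists_equiv_fin K
  refine ⟨n, fun i => OrdVect.ofQStrict (X (e.symm i)),
    fun i => ⟨X (e.symm i), inferInstance, inferInstance, OrderAddMonoidIso.refl _, rfl⟩,
    { Equiv.piCongrLeft' (fun k => QStrict (X k)) e with
      map_add' := fun f g => rfl
      map_le_map_iff' := fun {f g} => ⟨fun h k => ?_, fun h i => h (e.symm i)⟩ }, rfl⟩
  have := h (e k)
  change (f : ∀ k, QStrict (X k)) (e.symm (e k)) ≤ (g : ∀ k, QStrict (X k)) (e.symm (e k)) at this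
  rwa [e.symm_apply_apply] at this

variable {L : Type*} {Y : L → Type u}

/-- The linear map of a nonnegative matrix, between direct sums of spaces `ℚ_X`. -/
noncomputable def blockAddHom (M : (Σ l, Y l) → (Σ k, X k) → ℚ≥0) [Fintype (Σ k, X k)] :
    (∀ k, QStrict (X k)) →+ (∀ l, QStrict (Y l)) where
  toFun f := fun l y => ∑ a : Σ k, X k, (M ⟨l, y⟩ a : ℚ) * (f a.1 : X a.1 → ℚ) a.2
  map_zero' := by
    funext l y
    exact Finset.sum_eq_zero fun a _ => mul_zero _
  map_add' f g := by
    funext l y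
    change _ = (∑ a : Σ k, X k, (M ⟨l, y⟩ a : ℚ) * (f a.1 : X a.1 → ℚ) a.2) +
      ∑ a : Σ k, X k, (M ⟨l, y⟩ a : ℚ) * (g a.1 : X a.1 → ℚ) a.2
    rw [← Finset.sum_add_distrib]
    exact Finset.sum_congr rfl fun a _ => mul_add _ _ _

variable [Fintype (Σ k, X k)] {M : (Σ l, Y l) → (Σ k, X k) → ℚ≥0} {R : K → L → Prop}

theorem blockAddHom_apply (f : ∀ k, QStrict (X k)) (l : L) (y : Y l) :
    (blockAddHom M f l : Y l → ℚ) y =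
      ∑ a : Σ k, X k, (M ⟨l, y⟩ a : ℚ) * (f a.1 : X a.1 → ℚ) a.2 := rfl

/-- Since `f k` is positive at every point of its block, one nonzero entry of the row in block `k`
suffices, wherever it sits; the other summands are nonnegative. -/
theorem blockAddHom_apply_pos (hM : ∀ b k, (∃ a, M b ⟨k, a⟩ ≠ 0) ↔ R k b.1)
    {f : ∀ k, QStrict (X k)} (hf : 0 ≤ f) {k : K} {l : L} (hkl : R k l) (hk : f k ≠ 0) (y : Y l) :
    0 < (blockAddHom M f l : Y l → ℚ) y := by
  rw [blockAddHom_apply]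
  have hf' : ∀ k x, 0 ≤ (f k : X k → ℚ) x := fun k x => by
    rcases hf k with h | h
    · exact (congrFun h x).le
    · exact (h x).le
  obtain ⟨a, ha⟩ := (hM ⟨l, y⟩ k).2 hkl
  refine Finset.sum_pos' (fun a _ => mul_nonneg (NNRat.cast_nonneg _) (hf' _ _))
    ⟨⟨k, a⟩, Finset.mem_univ _, mul_pos ?_ ?_⟩
  · exact NNRat.cast_pos.2 (pos_iff_ne_zero.2 ha)
  · exact ((hf k).resolve_left fun h => hk h.symm) a

theorem blockAddHom_apply_eq_zero (hM : ∀ b k, (∃ a, M b ⟨k, a⟩ ≠ 0) ↔ R k b.1)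
    {f : ∀ k, QStrict (X k)} {l : L} (h : ∀ k, R k l → f k = 0) : blockAddHom M f l = 0 := by
  funext y
  change (blockAddHom M f l : Y l → ℚ) y = 0
  rw [blockAddHom_apply]
  refine Finset.sum_eq_zero fun a _ => ?_
  by_cases ha : M ⟨l, y⟩ a = 0
  · rw [ha]
    simp
  · rw [h a.1 ((hM ⟨l, y⟩ a.1).1 ⟨a.2, ha⟩)]
    exact mul_zero _

/-- All rows of a block `l` have the same pattern, so the image in `l` is either zero or positive at
every point, as the strict order requires. -/
theorem blockAddHom_nonneg (hM : ∀ b k, (∃ a, M b ⟨k, a⟩ ≠ 0) ↔ R k b.1)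
    {f : ∀ k, QStrict (X k)} (hf : 0 ≤ f) : 0 ≤ blockAddHom M f := by
  intro l
  by_cases h : ∀ k, R k l → f k = 0
  · rw [blockAddHom_apply_eq_zero hM h]
    exact le_rfl
  · push Not at h
    obtain ⟨k, h1, h2⟩ := h
    exact Or.inr (blockAddHom_apply_pos hM hf h1 h2)

/-- This recovers the relation from the matrix at the level of compact ideals. An empty block would
vanish for every `f`, hence the nonemptiness. -/
theorem blockAddHom_eq_zero_iff (hM : ∀ b k, (∃ a, M b ⟨k, a⟩ ≠ 0) ↔ R k b.1)
    {f : ∀ k, QStrict (X k)} (hf : 0 ≤ f) {l : L} [Nonempty (Y l)] :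
    blockAddHom M f l = 0 ↔ ∀ k, R k l → f k = 0 := by
  refine ⟨fun h k hkl => ?_, blockAddHom_apply_eq_zero hM⟩
  by_contra hk
  have y := Classical.arbitrary (Y l)
  exact (blockAddHom_apply_pos hM hf hkl hk y).ne' (congrFun h y)

/-- The positive homomorphism of a nonnegative matrix whose rows have the zero pattern `R`. -/
noncomputable def blockHom (M : (Σ l, Y l) → (Σ k, X k) → ℚ≥0)
    (hM : ∀ b k, (∃ a, M b ⟨k, a⟩ ≠ 0) ↔ R k b.1) :
    (∀ k, QStrict (X k)) →+o (∀ l, QStrict (Y l)) where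
  toAddMonoidHom := blockAddHom M
  monotone' f g h := by
    have := blockAddHom_nonneg hM (sub_nonneg.2 h)
    rw [map_sub] at this
    exact sub_nonneg.1 this

end BlockSpace

/-! ### Atoms of finite Boolean semilattices -/

section Atoms

variable {S : SemilatSupCat.{u}}

theorem IsFiniteBoolean.le_iff (hS : IsFiniteBoolean S) {s t : S} :
    s ≤ t ↔ ∀ a, IsAtom a → a ≤ s → a ≤ t := by
  obtain ⟨_, B, _, ⟨e⟩⟩ := hS
  have : Finite B := Finite.of_equiv S e.toEquiv
  rw [← e.le_iff_le, BooleanAlgebra.le_iff_atom_le_imp]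
  refine ⟨fun h a ha hs => ?_, fun h b hb hs => ?_⟩
  · exact e.le_iff_le.1 (h (e a) ((e.isAtom_iff a).2 ha) (e.le_iff_le.2 hs))
  · have := h (e.symm b) ((e.symm.isAtom_iff b).2 hb) (e.symm_apply_le.2 hs)
    exact e.symm_apply_le.1 this

/-- In the Boolean algebra an atom not below an element is disjoint from it, and by distributivity
an atom disjoint from both `s` and `t` is disjoint from their join. -/
theorem IsFiniteBoolean.le_sup (hS : IsFiniteBoolean S) {a s t : S} (ha : IsAtom a)
    (h : a ≤ s ⊔ t) : a ≤ s ∨ a ≤ t := by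
  obtain ⟨_, B, _, ⟨e⟩⟩ := hS
  have hb : IsAtom (e a) := (e.isAtom_iff a).2 ha
  rw [← e.le_iff_le, map_sup] at h
  rw [← e.le_iff_le, ← e.le_iff_le (x := a) (y := t)]
  by_contra! hc
  rw [hb.not_le_iff_disjoint, hb.not_le_iff_disjoint] at hc
  exact hb.1 (disjoint_self.1 ((hc.1.sup_right hc.2).mono_right h))

theorem IsFiniteBoolean.le_finset_sup (hS : IsFiniteBoolean S) {a : S} (ha : IsAtom a)
    {ι : Type*} (F : Finset ι) (f : ι → S) (h : a ≤ F.sup f) : ∃ i ∈ F, a ≤ f i := by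
  classical
  induction F using Finset.induction_on with
  | empty => exact absurd (le_bot_iff.1 h) ha.1
  | insert i F _ ih =>
    rw [Finset.sup_insert] at h
    rcases hS.le_sup ha h with h | h
    · exact ⟨i, Finset.mem_insert_self i F, h⟩
    · obtain ⟨j, hj, h⟩ := ih h
      exact ⟨j, Finset.mem_insert_of_mem hj, h⟩

/-- An atom below the image of `s` is below the image of an atom below `s`. -/
theorem IsFiniteBoolean.le_map_iff {T : SemilatSupCat.{u}} (hS : IsFiniteBoolean S)
    (hT : IsFiniteBoolean T) (φ : SupBotHom S T) {b : T} (hb : IsAtom b) (s : S) :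
    b ≤ φ s ↔ ∃ a, IsAtom a ∧ a ≤ s ∧ b ≤ φ a := by
  classical
  have := hS.1
  have := Fintype.ofFinite S
  have hmono : Monotone φ := OrderHomClass.mono φ
  refine ⟨fun h => ?_, fun ⟨a, _, h1, h2⟩ => h2.trans (hmono h1)⟩
  have hs : s = (Finset.univ.filter fun a => IsAtom a ∧ a ≤ s).sup id := by
    refine le_antisymm (hS.le_iff.2 fun a ha has => ?_) (Finset.sup_le fun a ha => ?_)
    · exact Finset.le_sup (f := id) (Finset.mem_filter.2 ⟨Finset.mem_univ a, ha, has⟩)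
    · exact (Finset.mem_filter.1 ha).2.2
  rw [hs, map_finset_sup] at h
  obtain ⟨a, ha, h⟩ := hT.le_finset_sup hb _ _ h
  exact ⟨a, (Finset.mem_filter.1 ha).2.1, (Finset.mem_filter.1 ha).2.2, h⟩

variable {X : {a : S // IsAtom a} → Type u}

open Classical in
/-- The indicator function of the blocks of the atoms below `s`. -/
noncomputable def atomIndicator (X : {a : S // IsAtom a} → Type u) (s : S) :
    ∀ k, QStrict (X k) :=
  fun k => if k.1 ≤ s then QStrict.one (X k) else 0

theorem atomIndicator_nonneg (s : S) : 0 ≤ atomIndicator X s := by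
  intro k
  rw [atomIndicator]
  split_ifs
  · exact Or.inr fun _ => zero_lt_one
  · exact le_rfl

theorem atomIndicator_eq_zero_iff [∀ k, Nonempty (X k)] (s : S) (k : {a : S // IsAtom a}) :
    atomIndicator X s k = 0 ↔ ¬ k.1 ≤ s := by
  rw [atomIndicator]
  split_ifs with h
  · refine ⟨fun h0 => ?_, fun h' => absurd h h'⟩
    exact absurd (congrFun h0 (Classical.arbitrary (X k))) one_ne_zero
  · simp [h]

/-- A finite Boolean semilattice is isomorphic to the compact ideals of a direct sum of
spaces `ℚ_X` indexed by its atoms. -/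
noncomputable def IsFiniteBoolean.orderIso (hS : IsFiniteBoolean S)
    [Finite {a : S // IsAtom a}] [∀ k, Finite (X k)] [∀ k, Nonempty (X k)] :
    S ≃o CompactIdeals (∀ k, QStrict (X k)) :=
  RelIso.ofSurjective
    (OrderEmbedding.ofMapLEIff
      (fun s => CompactIdeals.principal (atomIndicator X s) (atomIndicator_nonneg s)) (by
        intro s t
        refine (principalIdeal_pi_le_iff (atomIndicator_nonneg s) (atomIndicator_nonneg t)).trans ?_
        rw [hS.le_iff]
        simp only [atomIndicator_eq_zero_iff, not_imp_not, Subtype.forall]))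
    (by
      classical
      intro I
      obtain ⟨b, hb, rfl⟩ := I.exists_eq_principal
      have := Fintype.ofFinite {a : S // IsAtom a}
      -- The preimage of the ideal of `b` is the join of the atoms in whose blocks `b` is nonzero.
      -- No other atom lies below it, since atoms are join-prime and pairwise incomparable.
      refine ⟨(Finset.univ.filter fun k => b k ≠ 0).sup Subtype.val,
        (principal_pi_eq_iff (atomIndicator_nonneg _) hb).2 fun k => ?_⟩
      rw [atomIndicator_eq_zero_iff, ← not_iff_not, not_not]
      constructor
      · intro h
        obtain ⟨l, hl, hkl⟩ := hS.le_finset_sup k.2 _ _ h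
        have : k = l := Subtype.ext ((l.2.le_iff_eq k.2.1).1 hkl)
        rw [this]
        exact (Finset.mem_filter.1 hl).2
      · exact fun h => Finset.le_sup (f := Subtype.val)
          (Finset.mem_filter.2 ⟨Finset.mem_univ k, h⟩))

theorem IsFiniteBoolean.orderIso_apply (hS : IsFiniteBoolean S)
    [Finite {a : S // IsAtom a}] [∀ k, Finite (X k)] [∀ k, Nonempty (X k)] (s : S) :
    hS.orderIso (X := X) s =
      CompactIdeals.principal (atomIndicator X s) (atomIndicator_nonneg s) := rfl

end Atoms

/-! ### Assembly of the functor and of the natural isomorphism. -/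

theorem theoremT (P : Type w) [PartialOrder P] [Finite P] (hP : IsDismantlable P)
    (Φ : P ⥤ SemilatSupCat.{u}) (hΦ : ∀ x, IsFiniteBoolean (Φ.obj x)) :
    ∃ Ψ : P ⥤ OrdVect.{u},
      (∀ x, (Ψ.obj x).IsPseudoSimplicial) ∧ Nonempty (Φ ≅ Ψ ⋙ OrdVect.Idc) := by
  classical
  have hfin : ∀ x, Finite (Φ.obj x) := fun x => (hΦ x).1
  let K : P → Type u := fun x => {a : Φ.obj x // IsAtom a}
  have hK : ∀ x, Finite (K x) := fun x => Subtype.finite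
  let φ : ∀ {x y : P}, x ≤ y → SupBotHom (Φ.obj x) (Φ.obj y) := fun h => Φ.map (homOfLE h)
  have φ_id : ∀ x s, φ (le_refl x) s = s := fun x s =>
    congrArg (fun f : SupBotHom (Φ.obj x) (Φ.obj x) => f s) (Φ.map_id x)
  have φ_comp : ∀ {x y z} (h : x ≤ y) (h' : y ≤ z) s, φ (h.trans h') s = φ h' (φ h s) :=
    fun {x y z} h h' s => congrArg (fun f : SupBotHom (Φ.obj x) (Φ.obj z) => f s)
      (Φ.map_comp (homOfLE h) (homOfLE h'))
  let R : ∀ x y, K x → K y → Prop := fun x y k l => ∃ h : x ≤ y, l.1 ≤ φ h k.1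
  have R_iff : ∀ {x y} (h : x ≤ y) (k : K x) (l : K y), R x y k l ↔ l.1 ≤ φ h k.1 :=
    fun h k l => ⟨fun ⟨_, h'⟩ => h', fun h' => ⟨h, h'⟩⟩
  obtain ⟨X, hXfin, hXne, M, hM1, hM0, hMmul, hMR⟩ := hP.exists_blockMatrices K R
    (by
      intro x k l
      rw [R_iff le_rfl, φ_id, k.2.le_iff_eq l.2.1, Subtype.ext_iff, eq_comm])
    (by
      intro x y z hxy hyz k m
      rw [R_iff (hxy.trans hyz), φ_comp hxy hyz, (hΦ y).le_map_iff (hΦ z) (φ hyz) m.2]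
      constructor
      · rintro ⟨a, ha, h1, h2⟩
        exact ⟨⟨a, ha⟩, (R_iff hxy _ _).2 h1, (R_iff hyz _ _).2 h2⟩
      · rintro ⟨l, h1, h2⟩
        exact ⟨l.1, l.2, (R_iff hxy _ _).1 h1, (R_iff hyz _ _).1 h2⟩)
  have hft : ∀ x, Fintype (Σ k, X x k) := fun x => Fintype.ofFinite _
  let Ψ : P ⥤ OrdVect.{u} :=
    { obj := fun x => OrdVect.block (X x)
      map := fun {x y} h => blockHom (M x y) (hMR x y (leOfHom h))
      map_id := fun x => by
        refine OrderAddMonoidHom.ext fun f => ?_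
        funext l y
        refine (blockAddHom_apply (M := M x x) f l y).trans ?_
        rw [Finset.sum_eq_single ⟨l, y⟩]
        · rw [hM1, NNRat.cast_one, one_mul]
          rfl
        · intro a _ ha
          rw [hM0 x a _ ha, NNRat.cast_zero, zero_mul]
        · exact fun h => absurd (Finset.mem_univ _) h
      map_comp := fun {x y z} h h' => by
        refine OrderAddMonoidHom.ext fun f => ?_
        funext l c
        refine (blockAddHom_apply (M := M x z) f l c).trans ?_
        refine Eq.trans ?_
          (blockAddHom_apply (M := M y z) (blockAddHom (M x y) f) l c).symm
        simp only [blockAddHom_apply, Finset.mul_sum]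
        rw [Finset.sum_comm]
        refine Finset.sum_congr rfl fun a _ => ?_
        rw [← hMmul x y z (leOfHom h) (leOfHom h') a ⟨l, c⟩, finsum_eq_sum_of_fintype,
          NNRat.cast_sum, Finset.sum_mul]
        refine Finset.sum_congr rfl fun m _ => ?_
        rw [NNRat.cast_mul, mul_assoc] }
  refine ⟨Ψ, fun x => OrdVect.block_isPseudoSimplicial (X x),
    ⟨NatIso.ofComponents (fun x => SemilatSupCat.Iso.mk ((hΦ x).orderIso (X := X x))) ?_⟩⟩
  intro x y h
  refine SupBotHom.ext fun s => ?_
  change (hΦ y).orderIso (X := X y) (φ (leOfHom h) s) =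
    CompactIdeals.mapFun (blockHom (M x y) (hMR x y (leOfHom h)))
      ((hΦ x).orderIso (X := X x) s)
  -- Naturality compares two principal ideals, hence only the blocks on which their generators
  -- vanish. An atom `l` lies below the image of `s` exactly when it is related to some atom below
  -- `s`, which is the condition for the matrix image of the indicator of `s` to be nonzero on block
  -- `l`.
  rw [IsFiniteBoolean.orderIso_apply, IsFiniteBoolean.orderIso_apply,
    CompactIdeals.mapFun_principal, principal_pi_eq_iff]
  intro l
  rw [atomIndicator_eq_zero_iff, (hΦ x).le_map_iff (hΦ y) (φ (leOfHom h)) l.2]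
  refine Iff.trans ?_
    (blockAddHom_eq_zero_iff (hMR x y (leOfHom h)) (atomIndicator_nonneg s)).symm
  simp only [atomIndicator_eq_zero_iff]
  constructor
  · exact fun hn k hk hks => hn ⟨k.1, k.2, hks, (R_iff (leOfHom h) k l).1 hk⟩
  · rintro hn ⟨a, ha, h1, h2⟩
    exact hn ⟨a, ha⟩ ((R_iff (leOfHom h) _ l).2 h2) h1
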